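/- Let $\mathbf{A}$ be an additive category. Its Freyd category $\mathcal{A}(\mathbf{A})$ has as objects the morphisms $A=(a\xleftarrow{\rho_a} r_a)$ of $\mathbf{A}$; a morphism $A\to A'$ is represented by some $\alpha\colon a\to a'$ for which there is $\omega\colon r_a\to r_{a'}$ with $\alpha\circ\rho_a=\rho_{a'}\circ\omega$, and $\alpha,\alpha'$ represent the same morphism iff $\alpha-\alpha'$ factors through $\rho_{a'}$. Regard $\mathbf{A}$ as a full subcategory of $\mathcal{A}(\mathbf{A})$ via $\mathrm{emb}(a)=(a\leftarrow 0)$. An additive functor $F\colon\mathbf{A}\to\mathcal{A}(\mathbf{A})$ has the extension $\widehat F(A)=\mathrm{cok}(F(r_a)\to F(a))$, and a bilinear functor $T\colon\mathbf{A}\times\mathbf{A}\to\mathcal{A}(\mathbf{A})$ has the extension $A\otimes B:=\widehat T(A,B)=\mathrm{cok}\big(T(r_a,b)\oplus T(a,r_b)\to T(a,b)\big)$; both are right exact in each variable. A natural transformation $\nu$ between the restrictions to $\mathbf{A}$ of functors on powers of $\mathcal{A}(\mathbf{A})$ that are right exact in each variable has a unique extension $\widehat\nu$ to those functors; here $\widehat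 F$ restricted to $\mathbf{A}$ is identified with $F$. An f.p. prointernal hom structure on $\mathcal{A}(\mathbf{A})$ consists of the following. (1) An f.p. promonoidal structure on $\mathbf{A}$: a bilinear functor $T\colon\mathbf{A}\times\mathbf{A}\to\mathcal{A}(\mathbf{A})$; isomorphisms $a\otimes(b\otimes c)\cong(a\otimes b)\otimes c$ natural in $a,b,c\in\mathbf{A}$; an object $1\in\mathcal{A}(\mathbf{A})$; and isomorphisms $1\otimes a\cong a$ and $a\otimes 1\cong a$ natural in $a\in\mathbf{A}$; such that the pentagon and triangle identities, written with the extended associator, hold for all objects of $\mathbf{A}$. (2) For every $a\in\mathbf{A}$, an additive functor $\underline{\mathrm{Hom}}(a,-)\colon\mathbf{A}\to\mathcal{A}(\mathbf{A})$, whose extension is denoted $\widehat{\underline{\mathrm{Hom}}}(a,-)\colon\mathcal{A}(\mathbf{A})\to\mathcal{A}(\mathbf{A})$, together with morphisms $\mathrm{coev}_{b,a}\colon b\to\widehat{\underline{\mathrm{Hom}}}(a,b\otimes a)$ and $\mathrm{ev}_{a,b}\colon\underline{\mathrm{Hom}}(a,b)\otimes a\to b$, both natural in $b\in\mathbf{A}$,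 with extensions $\widehat{\mathrm{coev}}_{X,a}\colon X\to\widehat{\underline{\mathrm{Hom}}}(a,X\otimes a)$ and $\widehat{\mathrm{ev}}_{a,X}\colon\widehat{\underline{\mathrm{Hom}}}(a,X)\otimes a\to X$ for $X\in\mathcal{A}(\mathbf{A})$. These are subject to the condition that for all $a,b\in\mathbf{A}$ $$\widehat{\mathrm{ev}}_{a,\,b\otimes a}\circ(\widehat{\mathrm{coev}}_{b,a}\otimes a)=\mathrm{id}_{b\otimes a},\qquad \widehat{\underline{\mathrm{Hom}}}(a,\widehat{\mathrm{ev}}_{a,b})\circ\widehat{\mathrm{coev}}_{\widehat{\underline{\mathrm{Hom}}}(a,b),\,a}=\mathrm{id}_{\widehat{\underline{\mathrm{Hom}}}(a,b)}.$$ Lemma. Suppose given an f.p. prointernal hom structure on $\mathcal{A}(\mathbf{A})$. Then for every $a\in\mathbf{A}$ the functor $-\otimes a\colon\mathcal{A}(\mathbf{A})\to\mathcal{A}(\mathbf{A})$ is left adjoint to $\widehat{\underline{\mathrm{Hom}}}(a,-)\colon\mathcal{A}(\mathbf{A})\to\mathcal{A}(\mathbf{A})$, by an adjunction whose unit is $\widehat{\mathrm{coev}}_{-,a}$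 and whose counit is $\widehat{\mathrm{ev}}_{a,-}$. -/

import Mathlib

open CategoryTheory CategoryTheory.Limits CategoryTheory.Preadditive

noncomputable section

namespace FreydTensor

universe v u v' u'

set_option linter.unusedSectionVars false

section Presentation

variable {A : Type u} [Category.{v} A] [Preadditive A]

/-- The Freyd category `𝒜(A)` of an additive category `A`: objects are arrows `r ⟶ a` of `A`,
morphisms are the maps `a ⟶ a'` that admit a witness `r ⟶ r'`, taken up to maps that factor
through `r' ⟶ a'`. -/
abbrev Freyd (A : Type u) [Category.{v} A] [Preadditive A] : Type _ := RightFreyd A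

/-- The embedding `a ↦ (0 ⟶ a)` of `A` into its Freyd category. -/
abbrev emb (A : Type u) [Category.{v} A] [Preadditive A] [HasZeroObject A] : A ⥤ Freyd A :=
  RightFreyd.functor A

/-- The object of the Freyd category given by an arrow `r ⟶ a`. -/
abbrev pres (x : Arrow A) : Freyd A := (RightFreyd.quotient A).obj x

/-- Morphisms of arrows induce morphisms in the Freyd category. -/
abbrev presMap {x y : Arrow A} (f : x ⟶ y) : pres x ⟶ pres y := (RightFreyd.quotient A).map f

variable [HasZeroObject A]

/-- The canonical morphism of arrows `(0 ⟶ a) ⟶ (r ⟶ a)`. -/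
def projArrow (x : Arrow A) : (RightFreyd.rightFunctor A).obj x.right ⟶ x :=
  Arrow.homMk 0 (𝟙 x.right) (zero_comp.trans zero_comp.symm)

/-- The canonical projection `emb a ⟶ (r ⟶ a)` in the Freyd category. -/
def proj (x : Arrow A) : (emb A).obj x.right ⟶ pres x := presMap (projArrow x)

instance epi_proj (x : Arrow A) : Epi (proj x) :=
  have : IsIso (projArrow x).right := inferInstanceAs (IsIso (𝟙 x.right))
  RightFreyd.epi_of_isIso_right (projArrow x)

theorem proj_naturality {x y : Arrow A} (f : x ⟶ y) :
    (emb A).map f.right ≫ proj y = proj x ≫ presMap f := by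
  refine ((RightFreyd.quotient A).map_comp _ _).symm.trans
    (Eq.trans ?_ ((RightFreyd.quotient A).map_comp _ _))
  congr 1
  ext
  · apply (isZero_zero A).eq_of_src
  · exact (Category.comp_id f.right).trans (Category.id_comp f.right).symm

theorem map_hom_proj (x : Arrow A) : (emb A).map x.hom ≫ proj x = 0 := by
  rw [proj]
  refine ((RightFreyd.quotient A).map_comp _ _).symm.trans ?_
  rw [RightFreyd.quotient_map_eq_zero_iff]
  exact ⟨⟨𝟙 _, (sub_zero _).trans ((Category.comp_id x.hom).trans (Category.id_comp x.hom).symm)⟩⟩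

theorem exists_desc_proj (x : Arrow A) {Z : Freyd A} (k : (emb A).obj x.right ⟶ Z)
    (hk : (emb A).map x.hom ≫ k = 0) : ∃ l : pres x ⟶ Z, proj x ≫ l = k := by
  obtain ⟨z, rfl⟩ : ∃ z, Z = pres z := ⟨Z.as, rfl⟩
  obtain ⟨k, rfl⟩ := (RightFreyd.quotient A).map_surjective k
  obtain ⟨h, hh⟩ := (RightFreyd.quotient_map_eq_zero_iff _).1
    (((RightFreyd.quotient A).map_comp _ _).trans hk)
  refine ⟨presMap (Arrow.homMk h k.right (((sub_zero _).symm.trans hh).symm)), ?_⟩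
  refine ((RightFreyd.quotient A).map_comp _ _).symm.trans ?_
  congr 1
  ext
  · apply (isZero_zero A).eq_of_src
  · exact Category.id_comp k.right

/-- `(r ⟶ a)` is the cokernel of `emb r ⟶ emb a`. -/
def isColimitProj (x : Arrow A) :
    IsColimit (Cofork.ofπ (f := (emb A).map x.hom) (g := 0) (proj x)
      (by rw [map_hom_proj, zero_comp])) :=
  Cofork.IsColimit.mk' _ fun s =>
    have hs : (emb A).map x.hom ≫ s.π = 0 := by rw [s.condition, zero_comp]
    ⟨(exists_desc_proj x s.π hs).choose, (exists_desc_proj x s.π hs).choose_spec,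
      fun {m} hm => by
        rw [← cancel_epi (proj x)]
        exact hm.trans (exists_desc_proj x s.π hs).choose_spec.symm⟩

end Presentation

theorem exists_pres {A : Type u} [Category.{v} A] [Preadditive A] (X : Freyd A) :
    ∃ x : Arrow A, X = pres x := ⟨X.as, rfl⟩

section Extension

variable {A : Type u} [Category.{v} A] [Preadditive A]
  {B : Type u'} [Category.{v'} B] [Preadditive B] [HasCokernels B]

/-- The extension of an additive functor along presentations,
`(r ⟶ a) ↦ cok (F r ⟶ F a)`, on arrows. -/
def hatArrow (F : A ⥤ B) : Arrow A ⥤ B where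
  obj x := cokernel (F.map x.hom)
  map f := cokernel.map _ _ (F.map f.left) (F.map f.right)
    (by rw [← F.map_comp, ← F.map_comp, Arrow.w f])

/-- The extension `F̂ : 𝒜(A) ⥤ B` of an additive functor `F : A ⥤ B`. -/
def hat (F : A ⥤ B) [F.Additive] : Freyd A ⥤ B :=
  CategoryTheory.Quotient.lift _ (hatArrow F) (by
    rintro x y f g ⟨h⟩
    apply coequalizer.hom_ext
    simp only [hatArrow]
    erw [cokernel.π_desc, cokernel.π_desc]
    rw [← sub_eq_zero, ← sub_comp, ← F.map_sub, h.comm, F.map_comp, Category.assoc,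
      cokernel.condition, comp_zero])

/-- The projection `F a ⟶ F̂ (r ⟶ a) = cok (F r ⟶ F a)`. -/
def hatπ (F : A ⥤ B) [F.Additive] (x : Arrow A) : F.obj x.right ⟶ (hat F).obj (pres x) :=
  cokernel.π (F.map x.hom)

instance (F : A ⥤ B) [F.Additive] (x : Arrow A) : Epi (hatπ F x) :=
  inferInstanceAs (Epi (cokernel.π (F.map x.hom)))

theorem hatπ_naturality (F : A ⥤ B) [F.Additive] {x y : Arrow A} (f : x ⟶ y) :
    hatπ F x ≫ (hat F).map (presMap f) = F.map f.right ≫ hatπ F y :=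
  cokernel.π_desc _ _ _

instance hat_additive (F : A ⥤ B) [F.Additive] : (hat F).Additive where
  map_add {X Y f g} := by
    obtain ⟨x, rfl⟩ := exists_pres X
    obtain ⟨y, rfl⟩ := exists_pres Y
    obtain ⟨f, rfl⟩ := (RightFreyd.quotient A).map_surjective f
    obtain ⟨g, rfl⟩ := (RightFreyd.quotient A).map_surjective g
    have h : ∀ k : x ⟶ y, hatπ F x ≫ (hat F).map (presMap k) = F.map k.right ≫ hatπ F y :=
      fun k => hatπ_naturality F k
    rw [← Functor.map_add, ← cancel_epi (hatπ F x), comp_add, h, h, h, ← add_comp, ← F.map_add]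
    rfl

/-- Maps out of `F̂ (r ⟶ a)`. -/
def hatDesc (F : A ⥤ B) [F.Additive] (x : Arrow A) {Z : B} (k : F.obj x.right ⟶ Z)
    (hk : F.map x.hom ≫ k = 0) : (hat F).obj (pres x) ⟶ Z :=
  cokernel.desc _ k hk

theorem hatπ_desc (F : A ⥤ B) [F.Additive] (x : Arrow A) {Z : B} (k : F.obj x.right ⟶ Z)
    (hk : F.map x.hom ≫ k = 0) : hatπ F x ≫ hatDesc F x k hk = k :=
  cokernel.π_desc _ _ _

/-- `F̂` restricts to `F` along the embedding. -/
def hatRestrictIso [HasZeroObject A] (F : A ⥤ B) [F.Additive] : emb A ⋙ hat F ≅ F :=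
  Iso.symm <| NatIso.ofComponents (F := F) (G := emb A ⋙ hat F)
    (fun a =>
      { hom := hatπ F ((RightFreyd.rightFunctor A).obj a)
        inv := hatDesc F ((RightFreyd.rightFunctor A).obj a) (𝟙 (F.obj a))
          ((congrArg (· ≫ 𝟙 (F.obj a)) (F.map_zero _ _)).trans zero_comp)
        hom_inv_id := hatπ_desc _ _ _ _
        inv_hom_id := by
          refine (cancel_epi (hatπ F ((RightFreyd.rightFunctor A).obj a))).1 ?_
          refine (Category.assoc _ _ _).symm.trans ?_
          refine (congrArg (· ≫ hatπ F ((RightFreyd.rightFunctor A).obj a))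
            (hatπ_desc _ _ _ _)).trans ?_
          exact (Category.id_comp _).trans (Category.comp_id _).symm })
    (fun {a b} f => (hatπ_naturality F ((RightFreyd.rightFunctor A).map f)).symm)

/-- A bifunctor that is additive in each variable. -/
class Bilinear {C : Type*} [Category* C] [Preadditive C] {C' : Type*} [Category* C'] [Preadditive C']
    {D : Type*} [Category* D] [Preadditive D] (T : C ⥤ C' ⥤ D) : Prop where
  left : ∀ c' : C', (T.flip.obj c').Additive
  right : ∀ c : C, (T.obj c).Additive

attribute [instance] Bilinear.left Bilinear.right

variable [HasBinaryBiproducts B]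

/-- The object `cok (T (r, b) ⊕ T (a, s) ⟶ T (a, b))` for arrows `r ⟶ a` and `s ⟶ b`. -/
abbrev hatObj₂ (T : A ⥤ A ⥤ B) (x y : Arrow A) : B :=
  cokernel (biprod.desc ((T.map x.hom).app y.right) ((T.obj x.right).map y.hom))

/-- The projection `T (a, b) ⟶ cok (T (r, b) ⊕ T (a, s) ⟶ T (a, b))`. -/
abbrev hatπ₂ (T : A ⥤ A ⥤ B) (x y : Arrow A) : (T.obj x.right).obj y.right ⟶ hatObj₂ T x y :=
  cokernel.π _

theorem hom_left_hatπ₂ (T : A ⥤ A ⥤ B) (x y : Arrow A) :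
    (T.map x.hom).app y.right ≫ hatπ₂ T x y = 0 := by
  have h := cokernel.condition (biprod.desc ((T.map x.hom).app y.right) ((T.obj x.right).map y.hom))
  simpa only [biprod.inl_desc_assoc, comp_zero] using biprod.inl ≫= h

theorem hom_right_hatπ₂ (T : A ⥤ A ⥤ B) (x y : Arrow A) :
    (T.obj x.right).map y.hom ≫ hatπ₂ T x y = 0 := by
  have h := cokernel.condition (biprod.desc ((T.map x.hom).app y.right) ((T.obj x.right).map y.hom))
  simpa only [biprod.inr_desc_assoc, comp_zero] using biprod.inr ≫= h

/-- The map induced on cokernels by a pair of morphisms of arrows. -/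
def hatMap₂ (T : A ⥤ A ⥤ B) {x x' y y' : Arrow A} (f : x ⟶ x') (g : y ⟶ y') :
    hatObj₂ T x y ⟶ hatObj₂ T x' y' :=
  cokernel.map _ _
    (biprod.map ((T.map f.left).app y.right ≫ (T.obj x'.left).map g.right)
      ((T.map f.right).app y.left ≫ (T.obj x'.right).map g.left))
    ((T.map f.right).app y.right ≫ (T.obj x'.right).map g.right) (by
      ext
      · simp only [biprod.inl_desc_assoc, biprod.inl_map_assoc, biprod.inl_desc, Category.assoc,
          NatTrans.naturality, ← NatTrans.comp_app_assoc, ← T.map_comp, Arrow.w]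
      · simp only [biprod.inr_desc_assoc, biprod.inr_map_assoc, biprod.inr_desc, Category.assoc,
          ← Functor.map_comp, NatTrans.naturality_assoc, Arrow.w])

theorem hatπ₂_map (T : A ⥤ A ⥤ B) {x x' y y' : Arrow A} (f : x ⟶ x') (g : y ⟶ y') :
    hatπ₂ T x y ≫ hatMap₂ T f g =
      (T.map f.right).app y.right ≫ (T.obj x'.right).map g.right ≫ hatπ₂ T x' y' := by
  rw [hatMap₂, cokernel.π_desc, Category.assoc]

theorem exists_desc₂ (T : A ⥤ A ⥤ B) (x y : Arrow A) {Z : B}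
    (k : (T.obj x.right).obj y.right ⟶ Z) (h1 : (T.map x.hom).app y.right ≫ k = 0)
    (h2 : (T.obj x.right).map y.hom ≫ k = 0) : ∃ l : hatObj₂ T x y ⟶ Z, hatπ₂ T x y ≫ l = k :=
  ⟨cokernel.desc _ k (by
    ext
    · simpa only [biprod.inl_desc_assoc, comp_zero] using h1
    · simpa only [biprod.inr_desc_assoc, comp_zero] using h2), cokernel.π_desc _ _ _⟩

theorem hatMap₂_id (T : A ⥤ A ⥤ B) (x y : Arrow A) : hatMap₂ T (𝟙 x) (𝟙 y) = 𝟙 _ := by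
  rw [← cancel_epi (hatπ₂ T x y), hatπ₂_map]
  simp

theorem hatMap₂_comp (T : A ⥤ A ⥤ B) {x x' x'' y y' y'' : Arrow A} (f : x ⟶ x') (f' : x' ⟶ x'')
    (g : y ⟶ y') (g' : y' ⟶ y'') :
    hatMap₂ T (f ≫ f') (g ≫ g') = hatMap₂ T f g ≫ hatMap₂ T f' g' := by
  rw [← cancel_epi (hatπ₂ T x y), hatπ₂_map, ← Category.assoc (hatπ₂ T x y), hatπ₂_map T f g]
  simp [hatπ₂_map]

theorem hatMap₂_left (T : A ⥤ A ⥤ B) [Bilinear T] {x x' y y' : Arrow A} (f f' : x ⟶ x')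
    (g : y ⟶ y') (h : Arrow.RightHomotopy f f') : hatMap₂ T f g = hatMap₂ T f' g := by
  rw [← cancel_epi (hatπ₂ T x y), hatπ₂_map, hatπ₂_map, ← sub_eq_zero, ← sub_comp]
  have h1 : (T.map f.right).app y.right - (T.map f'.right).app y.right =
      (T.map h.hom).app y.right ≫ (T.map x'.hom).app y.right := by
    rw [← NatTrans.comp_app, ← T.map_comp, ← h.comm]
    exact ((T.flip.obj y.right).map_sub).symm
  rw [h1, Category.assoc, ← NatTrans.naturality_assoc, hom_left_hatπ₂, comp_zero, comp_zero]

theorem hatMap₂_right (T : A ⥤ A ⥤ B) [Bilinear T] {x x' y y' : Arrow A} (f : x ⟶ x')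
    (g g' : y ⟶ y') (h : Arrow.RightHomotopy g g') : hatMap₂ T f g = hatMap₂ T f g' := by
  rw [← cancel_epi (hatπ₂ T x y), hatπ₂_map, hatπ₂_map, ← sub_eq_zero, ← comp_sub, ← sub_comp,
    ← Functor.map_sub, h.comm, Functor.map_comp, Category.assoc, hom_right_hatπ₂, comp_zero,
    comp_zero]

/-- The functor `T̂(x, -)` for an arrow `x`. -/
def hatArrow₂Obj (T : A ⥤ A ⥤ B) [Bilinear T] (x : Arrow A) : Freyd A ⥤ B :=
  CategoryTheory.Quotient.lift (Arrow.rightHomotopic A)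
    { obj := fun y => hatObj₂ T x y
      map := fun g => hatMap₂ T (𝟙 x) g
      map_id := fun y => hatMap₂_id T x y
      map_comp := fun g g' => by rw [← hatMap₂_comp, Category.id_comp] }
    (fun _ _ g g' ⟨h⟩ => hatMap₂_right T (𝟙 x) g g' h)

/-- The bifunctor `T̂` with the first variable still an arrow. -/
def hatArrow₂ (T : A ⥤ A ⥤ B) [Bilinear T] : Arrow A ⥤ Freyd A ⥤ B where
  obj x := hatArrow₂Obj T x
  map {x x'} f := CategoryTheory.Quotient.natTransLift _
    { app := fun y => hatMap₂ T f (𝟙 y)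
      naturality := fun y y' g => by
        change hatMap₂ T (𝟙 x) g ≫ hatMap₂ T f (𝟙 y') = hatMap₂ T f (𝟙 y) ≫ hatMap₂ T (𝟙 x') g
        simp only [← hatMap₂_comp, Category.id_comp, Category.comp_id] }
  map_id x := by
    ext Y
    exact hatMap₂_id T x Y.as
  map_comp {x x' x''} f f' := by
    ext Y
    change hatMap₂ T (f ≫ f') (𝟙 Y.as) = hatMap₂ T f (𝟙 Y.as) ≫ hatMap₂ T f' (𝟙 Y.as)
    rw [← hatMap₂_comp, Category.id_comp]

/-- The extension `T̂ : 𝒜(A) × 𝒜(A) ⥤ B` of a bilinear functor `T : A × A ⥤ B`, in curried form: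
`((r ⟶ a), (s ⟶ b)) ↦ cok (T (r, b) ⊕ T (a, s) ⟶ T (a, b))`. -/
def hat₂ (T : A ⥤ A ⥤ B) [Bilinear T] : Freyd A ⥤ Freyd A ⥤ B :=
  CategoryTheory.Quotient.lift (Arrow.rightHomotopic A) (hatArrow₂ T) (by
    rintro x x' f f' ⟨h⟩
    ext Y
    exact hatMap₂_left T f f' (𝟙 Y.as) h)

theorem hat₂_map_app (T : A ⥤ A ⥤ B) [Bilinear T] {x x' : Arrow A} (f : x ⟶ x') (y : Arrow A) :
    ((hat₂ T).map (presMap f)).app (pres y) = hatMap₂ T f (𝟙 y) := rfl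

theorem hat₂_obj_map (T : A ⥤ A ⥤ B) [Bilinear T] (x : Arrow A) {y y' : Arrow A} (g : y ⟶ y') :
    ((hat₂ T).obj (pres x)).map (presMap g) = hatMap₂ T (𝟙 x) g := rfl

instance hat₂_bilinear (T : A ⥤ A ⥤ B) [Bilinear T] : Bilinear (hat₂ T) where
  left Y := by
    refine { map_add := fun {X X' f g} => ?_ }
    obtain ⟨y, rfl⟩ := exists_pres Y
    obtain ⟨x, rfl⟩ := exists_pres X
    obtain ⟨x', rfl⟩ := exists_pres X'
    obtain ⟨f, rfl⟩ := (RightFreyd.quotient A).map_surjective f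
    obtain ⟨g, rfl⟩ := (RightFreyd.quotient A).map_surjective g
    change hatMap₂ T (f + g) (𝟙 y) = hatMap₂ T f (𝟙 y) + hatMap₂ T g (𝟙 y)
    rw [← cancel_epi (hatπ₂ T x y), comp_add, hatπ₂_map, hatπ₂_map, hatπ₂_map, ← add_comp]
    congr 1
    exact (T.flip.obj y.right).map_add
  right X := by
    refine { map_add := fun {Y Y' f g} => ?_ }
    obtain ⟨x, rfl⟩ := exists_pres X
    obtain ⟨y, rfl⟩ := exists_pres Y
    obtain ⟨y', rfl⟩ := exists_pres Y'
    obtain ⟨f, rfl⟩ := (RightFreyd.quotient A).map_surjective f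
    obtain ⟨g, rfl⟩ := (RightFreyd.quotient A).map_surjective g
    change hatMap₂ T (𝟙 x) (f + g) = hatMap₂ T (𝟙 x) f + hatMap₂ T (𝟙 x) g
    rw [← cancel_epi (hatπ₂ T x y), comp_add, hatπ₂_map, hatπ₂_map, hatπ₂_map, ← comp_add,
      ← add_comp]
    congr 2
    exact (T.obj x.right).map_add

end Extension

section RightExact

variable {A : Type u} [Category.{v} A] [Preadditive A] [HasBinaryBiproducts A]
  {B : Type u'} [Category.{v'} B] [Preadditive B]

instance hasBinaryBiproducts_freyd : HasBinaryBiproducts (Freyd A) where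
  has_binary_biproduct X Y := by
    obtain ⟨x, rfl⟩ := exists_pres X
    obtain ⟨y, rfl⟩ := exists_pres Y
    have : HasBinaryBiproducts (Arrow A) := HasBinaryBiproducts.of_hasBinaryProducts
    let b := (RightFreyd.quotient A).mapBinaryBicone (BinaryBiproduct.bicone x y)
    exact ⟨⟨b, isBinaryBilimitOfTotal b (by
      have h := congrArg (RightFreyd.quotient A).map (biprod.total (X := x) (Y := y))
      rw [Functor.map_add, Functor.map_comp, Functor.map_comp] at h
      exact h.trans ((RightFreyd.quotient A).map_id _))⟩⟩

/-- A functor on the Freyd category that is given by cokernels preserves cokernels. -/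
theorem preservesCoequalizers_of_presentation (G : Freyd A ⥤ B) [G.Additive]
    {P Q : A ⥤ B} [P.Additive] (θ : Q ⟶ P) (p : ∀ x : Arrow A, P.obj x.right ⟶ G.obj (pres x))
    (hp : ∀ x, Epi (p x))
    (nat : ∀ {x y : Arrow A} (f : x ⟶ y), p x ≫ G.map (presMap f) = P.map f.right ≫ p y)
    (hom_p : ∀ x, P.map x.hom ≫ p x = 0) (θ_p : ∀ x : Arrow A, θ.app x.right ≫ p x = 0)
    (desc : ∀ (x : Arrow A) {Z : B} (k : P.obj x.right ⟶ Z), P.map x.hom ≫ k = 0 →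
      θ.app x.right ≫ k = 0 → ∃ l : G.obj (pres x) ⟶ Z, p x ≫ l = k) :
    PreservesColimitsOfShape WalkingParallelPair G := by
  have : ∀ {X Y : Freyd A} (f : X ⟶ Y), PreservesColimit (parallelPair f 0) G := by
    intro X Y f
    obtain ⟨x, rfl⟩ := exists_pres X
    obtain ⟨y, rfl⟩ := exists_pres Y
    obtain ⟨f, rfl⟩ := (RightFreyd.quotient A).map_surjective f
    apply preservesColimit_of_preserves_colimit_cocone
      (RightFreyd.Candidate.isColimitCokernelCofork f)
    apply (CokernelCofork.isColimitMapCoconeEquiv _ G).2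
    have hπ : p y ≫ G.map (presMap (RightFreyd.Candidate.π f)) =
        p (RightFreyd.Candidate.cokernel f) := by
      rw [nat]
      exact (congrArg (· ≫ p (RightFreyd.Candidate.cokernel f)) (P.map_id _)).trans
        (Category.id_comp _)
    have : Epi (G.map (presMap (RightFreyd.Candidate.π f))) := by
      have := hp (RightFreyd.Candidate.cokernel f)
      rw [← hπ] at this
      exact epi_of_epi (p y) _
    have : Epi (G.map (Cofork.π (RightFreyd.Candidate.cokernelCofork f))) := this
    have w : G.map ((RightFreyd.quotient A).map f) ≫
        G.map (Cofork.π (RightFreyd.Candidate.cokernelCofork f)) = 0 := by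
      rw [← G.map_comp, CokernelCofork.condition, G.map_zero]
    refine CokernelCofork.IsColimit.ofπ' _ w fun {Z} k hk => Nonempty.some ?_
    obtain ⟨l, hl⟩ := desc (RightFreyd.Candidate.cokernel f) (p y ≫ k) (by
      change P.map (biprod.desc y.hom f.right) ≫ p y ≫ k = 0
      have h : biprod.desc y.hom f.right = biprod.fst ≫ y.hom + biprod.snd ≫ f.right :=
        biprod.desc_eq
      rw [h, P.map_add, P.map_comp, P.map_comp, add_comp, Category.assoc, Category.assoc,
        ← Category.assoc (P.map y.hom), hom_p, ← Category.assoc (P.map f.right), ← nat,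
        Category.assoc]
      erw [hk]
      simp) (by
      rw [← Category.assoc]
      erw [θ_p y]
      rw [zero_comp])
    refine ⟨⟨l, ?_⟩⟩
    have := hp y
    refine (cancel_epi (p y)).1 ?_
    refine (Category.assoc _ _ _).symm.trans ?_
    exact (congrArg (· ≫ l) hπ).trans hl
  exact Functor.preservesCoequalizers_of_preservesCokernels G

variable [HasCokernels B]

instance hat_preserves (F : A ⥤ B) [F.Additive] :
    PreservesColimitsOfShape WalkingParallelPair (hat F) :=
  preservesCoequalizers_of_presentation (hat F) (0 : F ⟶ F) (hatπ F) inferInstance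
    (fun f => hatπ_naturality F f) (fun _ => cokernel.condition _) (fun _ => zero_comp)
    (fun _ _ k hk _ => ⟨cokernel.desc _ k hk, cokernel.π_desc _ _ _⟩)

variable [HasBinaryBiproducts B]

instance hat₂_obj_preserves (T : A ⥤ A ⥤ B) [Bilinear T] (X : Freyd A) :
    PreservesColimitsOfShape WalkingParallelPair ((hat₂ T).obj X) := by
  obtain ⟨x, rfl⟩ := exists_pres X
  refine preservesCoequalizers_of_presentation ((hat₂ T).obj (pres x)) (T.map x.hom)
    (hatπ₂ T x) (fun y => inferInstanceAs (Epi (hatπ₂ T x y))) (fun {y y'} g => ?_)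
    (hom_right_hatπ₂ T x) (hom_left_hatπ₂ T x) (fun y Z k h1 h2 => exists_desc₂ T x y k h2 h1)
  refine (hatπ₂_map T (𝟙 x) g).trans ?_
  rw [Arrow.id_right, T.map_id, NatTrans.id_app, Category.id_comp]
  rfl

instance hat₂_flip_obj_preserves (T : A ⥤ A ⥤ B) [Bilinear T] (Y : Freyd A) :
    PreservesColimitsOfShape WalkingParallelPair ((hat₂ T).flip.obj Y) := by
  obtain ⟨y, rfl⟩ := exists_pres Y
  refine preservesCoequalizers_of_presentation ((hat₂ T).flip.obj (pres y))
    (T.flip.map y.hom) (fun x => hatπ₂ T x y) (fun x => inferInstanceAs (Epi (hatπ₂ T x y)))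
    (fun {x x'} f => ?_) (fun x => hom_left_hatπ₂ T x y) (fun x => hom_right_hatπ₂ T x y)
    (fun x Z k h1 h2 => exists_desc₂ T x y k h1 h2)
  refine (hatπ₂_map T f (𝟙 y)).trans ?_
  refine congrArg ((T.map f.right).app y.right ≫ ·) ?_
  exact (congrArg (· ≫ hatπ₂ T x' y) ((T.obj x'.right).map_id y.right)).trans
    (Category.id_comp _)

theorem preserves_of_evaluation {J C D E : Type*} [Category* J] [Category* C] [Category* D]
    [Category* E] (F : C ⥤ D ⥤ E) (h : ∀ d, PreservesColimitsOfShape J (F.flip.obj d)) :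
    PreservesColimitsOfShape J F :=
  preservesColimitsOfShape_of_evaluation F J h

end RightExact

section NatTransExtension

variable {A : Type u} [Category.{v} A] [Preadditive A] [HasZeroObject A]

section One

variable {D : Type*} [Category* D]

/-- If `F` is right exact, `F (r ⟶ a)` is the coequalizer of `F (emb r) ⇉ F (emb a)`. -/
def isColimitMapProj (F : Freyd A ⥤ D) [PreservesColimitsOfShape WalkingParallelPair F]
    (x : Arrow A) :
    IsColimit (Cofork.ofπ (f := F.map ((emb A).map x.hom)) (g := F.map 0) (F.map (proj x))
      (by rw [← F.map_comp, ← F.map_comp, map_hom_proj, zero_comp])) :=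
  isColimitCoforkMapOfIsColimit F _ (isColimitProj x)

theorem epi_map_proj (F : Freyd A ⥤ D) [PreservesColimitsOfShape WalkingParallelPair F]
    (x : Arrow A) : Epi (F.map (proj x)) :=
  ⟨fun _ _ h => Cofork.IsColimit.hom_ext (isColimitMapProj F x) h⟩

/-- Component of the extension of a natural transformation at `(r ⟶ a)`. -/
def extApp {F G : Freyd A ⥤ D} [PreservesColimitsOfShape WalkingParallelPair F]
    (ν : emb A ⋙ F ⟶ emb A ⋙ G) (x : Arrow A) : F.obj (pres x) ⟶ G.obj (pres x) :=
  Cofork.IsColimit.desc (isColimitMapProj F x) (ν.app x.right ≫ G.map (proj x)) (by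
    have h1 : F.map ((emb A).map x.hom) ≫ ν.app x.right ≫ G.map (proj x) =
        ν.app x.left ≫ G.map ((emb A).map x.hom) ≫ G.map (proj x) :=
      ν.naturality_assoc x.hom (G.map (proj x))
    have h2 : F.map ((emb A).map 0) ≫ ν.app x.right ≫ G.map (proj x) =
        ν.app x.left ≫ G.map ((emb A).map 0) ≫ G.map (proj x) :=
      ν.naturality_assoc (0 : x.left ⟶ x.right) (G.map (proj x))
    have e : (emb A).map (0 : x.left ⟶ x.right) = 0 := (emb A).map_zero _ _
    rw [← G.map_comp, map_hom_proj] at h1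
    rw [← G.map_comp, e, zero_comp] at h2
    rw [h1, h2])

theorem map_proj_extApp {F G : Freyd A ⥤ D} [PreservesColimitsOfShape WalkingParallelPair F]
    (ν : emb A ⋙ F ⟶ emb A ⋙ G) (x : Arrow A) :
    F.map (proj x) ≫ extApp ν x = ν.app x.right ≫ G.map (proj x) :=
  Cofork.IsColimit.π_desc' (isColimitMapProj F x) _ _

/-- The extension of a natural transformation `ν` between the restrictions to `A` of functors on
`𝒜(A)`, the first of which is right exact. -/
def ext₁ {F G : Freyd A ⥤ D} [PreservesColimitsOfShape WalkingParallelPair F]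
    (ν : emb A ⋙ F ⟶ emb A ⋙ G) : F ⟶ G :=
  CategoryTheory.Quotient.natTransLift _
    { app := fun x => extApp ν x
      naturality := fun x y f => by
        change F.map (presMap f) ≫ extApp ν y = extApp ν x ≫ G.map (presMap f)
        have := epi_map_proj F x
        rw [← cancel_epi (F.map (proj x)), ← Category.assoc, ← F.map_comp, ← proj_naturality,
          F.map_comp, Category.assoc, map_proj_extApp, ← Category.assoc, ← Category.assoc,
          map_proj_extApp, Category.assoc (ν.app x.right), ← G.map_comp, ← proj_naturality,
          G.map_comp, ← Category.assoc]
        exact congrArg (· ≫ G.map (proj y)) (ν.naturality f.right) }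

theorem hom_ext₁ {F G : Freyd A ⥤ D} [PreservesColimitsOfShape WalkingParallelPair F]
    {μ ν : F ⟶ G} (h : ∀ a : A, μ.app ((emb A).obj a) = ν.app ((emb A).obj a)) : μ = ν := by
  ext X
  obtain ⟨x, rfl⟩ := exists_pres X
  have := epi_map_proj F x
  rw [← cancel_epi (F.map (proj x)), μ.naturality, ν.naturality, h]

/-- The extension restricts to the given transformation. -/
theorem ext₁_app_emb {F G : Freyd A ⥤ D} [PreservesColimitsOfShape WalkingParallelPair F]
    (ν : emb A ⋙ F ⟶ emb A ⋙ G) (a : A) : (ext₁ ν).app ((emb A).obj a) = ν.app a := by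
  have h : proj ((RightFreyd.rightFunctor A).obj a) = 𝟙 ((emb A).obj a) := by
    refine Eq.trans ?_ ((RightFreyd.quotient A).map_id _)
    refine congrArg (RightFreyd.quotient A).map ?_
    ext
    · apply (isZero_zero A).eq_of_src
    · rfl
  have e := map_proj_extApp ν ((RightFreyd.rightFunctor A).obj a)
  rw [h] at e
  have e1 := (Category.id_comp _).symm.trans ((congrArg (· ≫ extApp ν _) (F.map_id _)).symm.trans e)
  refine e1.trans ?_
  exact (congrArg (ν.app a ≫ ·) (G.map_id _)).trans (Category.comp_id _)

end One

/-- A bifunctor on the Freyd category that is right exact in each variable. -/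
class RightExact₂ {D : Type*} [Category* D] (F : Freyd A ⥤ Freyd A ⥤ D) : Prop where
  left : ∀ Y, PreservesColimitsOfShape WalkingParallelPair (F.flip.obj Y)
  right : ∀ X, PreservesColimitsOfShape WalkingParallelPair (F.obj X)

/-- A trifunctor on the Freyd category that is right exact in each variable. -/
class RightExact₃ {D : Type*} [Category* D] (F : Freyd A ⥤ Freyd A ⥤ Freyd A ⥤ D) : Prop where
  left : ∀ Y Z, PreservesColimitsOfShape WalkingParallelPair ((F.flip.obj Y).flip.obj Z)
  right : ∀ X, RightExact₂ (F.obj X)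

attribute [instance] RightExact₂.right RightExact₃.right

instance RightExact₂.preserves {D : Type*} [Category* D] (F : Freyd A ⥤ Freyd A ⥤ D)
    [RightExact₂ F] : PreservesColimitsOfShape WalkingParallelPair F :=
  preserves_of_evaluation F RightExact₂.left

instance RightExact₃.preserves {D : Type*} [Category* D] (F : Freyd A ⥤ Freyd A ⥤ Freyd A ⥤ D)
    [RightExact₃ F] : PreservesColimitsOfShape WalkingParallelPair F :=
  preserves_of_evaluation F fun Y => preserves_of_evaluation _ (RightExact₃.left Y)

section Two

variable {D : Type*} [Category* D]

/-- Restriction of a bifunctor on `𝒜(A)` to `A`. -/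
abbrev restrict₂ (F : Freyd A ⥤ Freyd A ⥤ D) : A ⥤ A ⥤ D :=
  (((Functor.whiskeringLeft₂ D).obj (emb A)).obj (emb A)).obj F

/-- Restriction of a trifunctor on `𝒜(A)` to `A`. -/
abbrev restrict₃ (F : Freyd A ⥤ Freyd A ⥤ Freyd A ⥤ D) : A ⥤ A ⥤ A ⥤ D :=
  ((((Functor.whiskeringLeft₃ D).obj (emb A)).obj (emb A)).obj (emb A)).obj F

/-- The extension of a natural transformation in two variables. -/
def ext₂ {F G : Freyd A ⥤ Freyd A ⥤ D} [RightExact₂ F] (ν : restrict₂ F ⟶ restrict₂ G) : F ⟶ G :=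
  ext₁
    { app := fun a => ext₁ (F := F.obj ((emb A).obj a)) (G := G.obj ((emb A).obj a)) (ν.app a)
      naturality := fun a a' f => hom_ext₁ (F := F.obj ((emb A).obj a)) fun b => by
        change (F.map ((emb A).map f)).app ((emb A).obj b) ≫
            (ext₁ (F := F.obj ((emb A).obj a')) (ν.app a')).app ((emb A).obj b) =
          (ext₁ (F := F.obj ((emb A).obj a)) (ν.app a)).app ((emb A).obj b) ≫
            (G.map ((emb A).map f)).app ((emb A).obj b)
        rw [ext₁_app_emb, ext₁_app_emb]
        exact NatTrans.congr_app (ν.naturality f) b }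

theorem hom_ext₂ {F G : Freyd A ⥤ Freyd A ⥤ D} [RightExact₂ F] {μ ν : F ⟶ G}
    (h : ∀ a b : A, (μ.app ((emb A).obj a)).app ((emb A).obj b) =
      (ν.app ((emb A).obj a)).app ((emb A).obj b)) : μ = ν :=
  hom_ext₁ fun a => hom_ext₁ (h a)

theorem ext₂_app_emb {F G : Freyd A ⥤ Freyd A ⥤ D} [RightExact₂ F]
    (ν : restrict₂ F ⟶ restrict₂ G) (a b : A) :
    ((ext₂ ν).app ((emb A).obj a)).app ((emb A).obj b) = (ν.app a).app b := by
  rw [ext₂, ext₁_app_emb]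
  exact ext₁_app_emb _ b

/-- The extension of a natural transformation in three variables. -/
def ext₃ {F G : Freyd A ⥤ Freyd A ⥤ Freyd A ⥤ D} [RightExact₃ F]
    (ν : restrict₃ F ⟶ restrict₃ G) : F ⟶ G :=
  ext₁
    { app := fun a => ext₂ (F := F.obj ((emb A).obj a)) (G := G.obj ((emb A).obj a)) (ν.app a)
      naturality := fun a a' f => hom_ext₂ (F := F.obj ((emb A).obj a)) fun b c => by
        change ((F.map ((emb A).map f)).app ((emb A).obj b)).app ((emb A).obj c) ≫
            ((ext₂ (F := F.obj ((emb A).obj a')) (ν.app a')).app ((emb A).obj b)).app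
              ((emb A).obj c) =
          ((ext₂ (F := F.obj ((emb A).obj a)) (ν.app a)).app ((emb A).obj b)).app
              ((emb A).obj c) ≫
            ((G.map ((emb A).map f)).app ((emb A).obj b)).app ((emb A).obj c)
        rw [ext₂_app_emb, ext₂_app_emb]
        exact NatTrans.congr_app (NatTrans.congr_app (ν.naturality f) b) c }

/-- The extension in three variables restricts to the given transformation. -/
theorem ext₃_app_emb {F G : Freyd A ⥤ Freyd A ⥤ Freyd A ⥤ D} [RightExact₃ F]
    (ν : restrict₃ F ⟶ restrict₃ G) (a b c : A) :
    (((ext₃ ν).app ((emb A).obj a)).app ((emb A).obj b)).app ((emb A).obj c) =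
      ((ν.app a).app b).app c := by
  rw [ext₃, ext₁_app_emb]
  exact ext₂_app_emb _ b c

end Two

end NatTransExtension

section Structures

variable (A : Type u) [Category.{v} A] [Preadditive A] [HasZeroObject A] [HasBinaryBiproducts A]

variable {A} in
instance hat₂_rightExact (T : A ⥤ A ⥤ Freyd A) [Bilinear T] : RightExact₂ (hat₂ T) where
  left := hat₂_flip_obj_preserves T
  right := hat₂_obj_preserves T

variable {A} in
instance tensor_right_rightExact (T : A ⥤ A ⥤ Freyd A) [Bilinear T] :
    RightExact₃ (bifunctorComp₂₃ (hat₂ T) (hat₂ T)) where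
  left Y Z := hat₂_flip_obj_preserves T (((hat₂ T).obj Y).obj Z)
  right X :=
    { left := fun Z => comp_preservesColimitsOfShape ((hat₂ T).flip.obj Z) ((hat₂ T).obj X)
      right := fun Y => comp_preservesColimitsOfShape ((hat₂ T).obj Y) ((hat₂ T).obj X) }

/-- The data of an f.p. prosemimonoidal structure: a protensor product and a proassociator. -/
structure ProsemimonoidalData where
  /-- The protensor product `T : A × A ⥤ 𝒜(A)`. -/
  T : A ⥤ A ⥤ Freyd A
  bilinear : Bilinear T
  /-- The proassociator `a ⊗ (b ⊗ c) ≅ (a ⊗ b) ⊗ c`, natural in `a b c : A`; here `⊗` is `T̂`. -/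
  assoc : restrict₃ (bifunctorComp₂₃ (hat₂ T) (hat₂ T)) ≅
    restrict₃ (bifunctorComp₁₂ (hat₂ T) (hat₂ T))

namespace ProsemimonoidalData

attribute [instance] ProsemimonoidalData.bilinear

variable {A} (S : ProsemimonoidalData A)

/-- The extended tensor product `⊗ = T̂` on `𝒜(A)`. -/
def tensor : Freyd A ⥤ Freyd A ⥤ Freyd A := hat₂ S.T

/-- The object `X ⊗ Y`. -/
abbrev tobj (X Y : Freyd A) : Freyd A := (S.tensor.obj X).obj Y

/-- The functor `- ⊗ Y` on `𝒜(A)`. -/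
abbrev tensorRight (Y : Freyd A) : Freyd A ⥤ Freyd A := S.tensor.flip.obj Y

/-- The functor `X ⊗ -` on `𝒜(A)`. -/
abbrev tensorLeft (X : Freyd A) : Freyd A ⥤ Freyd A := S.tensor.obj X

/-- The extended associator `X ⊗ (Y ⊗ Z) ⟶ (X ⊗ Y) ⊗ Z`. -/
def assocHat (X Y Z : Freyd A) : S.tobj X (S.tobj Y Z) ⟶ S.tobj (S.tobj X Y) Z :=
  (((ext₃ S.assoc.hom).app X).app Y).app Z

end ProsemimonoidalData

/-- An f.p. prosemimonoidal structure on `A`. -/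
structure Prosemimonoidal extends ProsemimonoidalData A where
  /-- The pentagon identity, restricted to objects of `A`. -/
  pentagon : ∀ a b c d : A,
    (toProsemimonoidalData.tensorLeft ((emb A).obj a)).map
        (toProsemimonoidalData.assocHat ((emb A).obj b) ((emb A).obj c) ((emb A).obj d)) ≫
      toProsemimonoidalData.assocHat ((emb A).obj a)
        (toProsemimonoidalData.tobj ((emb A).obj b) ((emb A).obj c)) ((emb A).obj d) ≫
      (toProsemimonoidalData.tensorRight ((emb A).obj d)).map
        (toProsemimonoidalData.assocHat ((emb A).obj a) ((emb A).obj b) ((emb A).obj c)) =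
    toProsemimonoidalData.assocHat ((emb A).obj a) ((emb A).obj b)
        (toProsemimonoidalData.tobj ((emb A).obj c) ((emb A).obj d)) ≫
      toProsemimonoidalData.assocHat
        (toProsemimonoidalData.tobj ((emb A).obj a) ((emb A).obj b))
        ((emb A).obj c) ((emb A).obj d)

/-- An f.p. promonoidal structure on `A`. -/
structure Promonoidal extends Prosemimonoidal A where
  /-- The protensor unit `1 ∈ 𝒜(A)`. -/
  unit : Freyd A
  /-- The left prounitor `1 ⊗ a ≅ a`, natural in `a : A`. -/
  leftUnitor : emb A ⋙ toProsemimonoidalData.tensorLeft unit ≅ emb A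
  /-- The right prounitor `a ⊗ 1 ≅ a`, natural in `a : A`. -/
  rightUnitor : emb A ⋙ toProsemimonoidalData.tensorRight unit ≅ emb A
  /-- The triangle identity, restricted to objects of `A`. -/
  triangle : ∀ a b : A,
    toProsemimonoidalData.assocHat ((emb A).obj a) unit ((emb A).obj b) ≫
      (toProsemimonoidalData.tensorRight ((emb A).obj b)).map (rightUnitor.hom.app a) =
    (toProsemimonoidalData.tensorLeft ((emb A).obj a)).map (leftUnitor.hom.app b)

/-- The data of an f.p. prointernal hom structure on top of an f.p. promonoidal structure. -/
structure ProinternalHomData extends Promonoidal A where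
  /-- The prointernal homs `Hom(a, -) : A ⥤ 𝒜(A)`. -/
  ihom : A → A ⥤ Freyd A
  ihom_additive : ∀ a, (ihom a).Additive
  /-- The procoevaluations `b ⟶ Hom(a, b ⊗ a)`, natural in `b : A`. -/
  coev : ∀ a : A, emb A ⟶
    emb A ⋙ toProsemimonoidalData.tensorRight ((emb A).obj a) ⋙ hat (ihom a)
  /-- The proevaluations `Hom(a, b) ⊗ a ⟶ b`, natural in `b : A`. -/
  ev : ∀ a : A, ihom a ⋙ toProsemimonoidalData.tensorRight ((emb A).obj a) ⟶ emb A

namespace ProinternalHomData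

attribute [instance] ProinternalHomData.ihom_additive

variable {A} (S : ProinternalHomData A)

/-- The functor `- ⊗ a` on `𝒜(A)`, for `a : A`. -/
abbrev tensorWith (a : A) : Freyd A ⥤ Freyd A := S.tensorRight ((emb A).obj a)

/-- The extended prointernal hom on `𝒜(A)`. -/
abbrev ihomHat (a : A) : Freyd A ⥤ Freyd A := hat (S.ihom a)

instance tensorWith_preserves (a : A) :
    PreservesColimitsOfShape WalkingParallelPair (S.tensorWith a) :=
  hat₂_flip_obj_preserves S.T ((emb A).obj a)

/-- The extended coevaluation `X ⟶ Hom(a, X ⊗ a)`, natural in `X : 𝒜(A)`. -/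
def coevHat (a : A) : 𝟭 (Freyd A) ⟶ S.tensorWith a ⋙ S.ihomHat a :=
  ext₁ ((Functor.rightUnitor (emb A)).hom ≫ S.coev a)

/-- The extended evaluation `Hom(a, X) ⊗ a ⟶ X`, natural in `X : 𝒜(A)`. -/
def evHat (a : A) : S.ihomHat a ⋙ S.tensorWith a ⟶ 𝟭 (Freyd A) :=
  ext₁ ((Functor.associator (emb A) (S.ihomHat a) (S.tensorWith a)).inv ≫
    Functor.whiskerRight (hatRestrictIso (S.ihom a)).hom (S.tensorWith a) ≫ S.ev a ≫
      (Functor.rightUnitor (emb A)).inv)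

end ProinternalHomData

/-- An f.p. prointernal hom structure: the zigzag identities of the extended coevaluation and
evaluation are required on objects of `A` only. -/
structure ProinternalHom extends ProinternalHomData A where
  /-- `b ⊗ a ⟶ Hom(a, b ⊗ a) ⊗ a ⟶ b ⊗ a` is the identity for `a b : A`. -/
  zigzag_left : ∀ a b : A,
    (toProinternalHomData.tensorWith a).map ((toProinternalHomData.coevHat a).app ((emb A).obj b)) ≫
      (toProinternalHomData.evHat a).app ((toProinternalHomData.tensorWith a).obj ((emb A).obj b)) =
    𝟙 ((toProinternalHomData.tensorWith a).obj ((emb A).obj b))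
  /-- `Hom(a, b) ⟶ Hom(a, Hom(a, b) ⊗ a) ⟶ Hom(a, b)` is the identity for `a b : A`. -/
  zigzag_right : ∀ a b : A,
    (toProinternalHomData.coevHat a).app ((toProinternalHomData.ihomHat a).obj ((emb A).obj b)) ≫
      (toProinternalHomData.ihomHat a).map ((toProinternalHomData.evHat a).app ((emb A).obj b)) =
    𝟙 ((toProinternalHomData.ihomHat a).obj ((emb A).obj b))

end Structures

end FreydTensor

end

/-! An adjunction is a unit and a counit satisfying the two triangle identities. The extended
coevaluation and evaluation are already natural on all of `𝒜(A)`, so only the triangle identities at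
an arbitrary `X` are missing; the structure supplies them at objects `emb b`.

The passage from `A` to `𝒜(A)` is a density argument. An object `X = (r ⟶ x)` is the cokernel of
`emb r ⟶ emb x`, so a functor `F` preserving coequalizers sends the projection `emb x ⟶ X` to an
epimorphism. For natural transformations `μ, ν : F ⟶ G`, naturality at this projection writes `F(emb
x) ⟶ F(X) ⟶ G(X)` as the component at `emb x` followed by `G(emb x) ⟶ G(X)`. If `μ` and `ν` agree on
`A`, cancelling the epimorphism gives agreement at `X`. This is `FreydTensor.hom_ext₁`; only the
source `F` has to be right exact.

It is applied with `F = G = - ⊗ a` and with `F = G` the extended hom, comparing a triangle composite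
with the identity. The first functor is right exact by `tensorWith_preserves`, because the extended
tensor product is a cokernel in each variable. The second is right exact by `hat_preserves`: this is
not a consequence of being a right adjoint, but holds because the functor is defined as the cokernel
extension of its values on `A`. Binary biproducts in `A` enter here, through the construction of
cokernels in `𝒜(A)`. -/

theorem mainTheorem3 {A : Type*} [Category* A] [Preadditive A] [HasZeroObject A]
    [HasBinaryBiproducts A] (S : FreydTensor.ProinternalHom A) (a : A) :
    ∃ adj : S.tensorWith a ⊣ S.ihomHat a, adj.unit = S.coevHat a ∧ adj.counit = S.evHat a := by
  -- The triangle composites are endomorphisms of right exact functors, so they are determined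
  -- by their components at objects of `A`.
  have left : ∀ X, (S.tensorWith a).map ((S.coevHat a).app X) ≫
      (S.evHat a).app ((S.tensorWith a).obj X) = 𝟙 ((S.tensorWith a).obj X) := by
    -- The comparison on `A` concerns natural transformations, so the family of composites must
    -- first be assembled into one.
    let τ : S.tensorWith a ⟶ S.tensorWith a :=
      { app := fun X => (S.tensorWith a).map ((S.coevHat a).app X) ≫
          (S.evHat a).app ((S.tensorWith a).obj X)
        naturality := fun X Y f => by
          -- Two squares are pasted: the image under `- ⊗ a` of the coevaluation square at `f`, and
          -- the evaluation square at `f ⊗ a`.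
          rw [← Functor.map_comp_assoc]
          erw [(S.coevHat a).naturality f, Functor.map_comp_assoc,
            (S.evHat a).naturality ((S.tensorWith a).map f)]
          exact (Category.assoc _ _ _).symm }
    -- The assumed identity already involves the extended evaluation at `b ⊗ a`, which need not lie
    -- in the image of `emb`; hence it is exactly the component of `τ` at `emb b`.
    have h : τ = 𝟙 _ := FreydTensor.hom_ext₁ fun b => S.zigzag_left a b
    exact fun X => NatTrans.congr_app h X
  have right : ∀ X, (S.coevHat a).app ((S.ihomHat a).obj X) ≫
      (S.ihomHat a).map ((S.evHat a).app X) = 𝟙 ((S.ihomHat a).obj X) := by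
    let τ : S.ihomHat a ⟶ S.ihomHat a :=
      { app := fun X => (S.coevHat a).app ((S.ihomHat a).obj X) ≫
          (S.ihomHat a).map ((S.evHat a).app X)
        naturality := fun X Y f => by
          -- The order is reversed compared with the first triangle: the coevaluation square is
          -- taken at `Hom(a, f)`, and the evaluation square at `f` is transported by `Hom(a, -)`.
          have h1 := (S.coevHat a).naturality ((S.ihomHat a).map f)
          have h2 := congrArg (S.ihomHat a).map ((S.evHat a).naturality f)
          rw [Functor.map_comp, Functor.map_comp] at h2
          refine (Category.assoc _ _ _).symm.trans ((congrArg (· ≫ _) h1).trans ?_)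
          refine (Category.assoc _ _ _).trans ((congrArg (_ ≫ ·) h2).trans ?_)
          exact (Category.assoc _ _ _).symm }
    -- Right exactness of the extended hom is what allows the reduction to `emb b` here; it comes
    -- from the cokernel formula alone, so no circular use of the adjunction is made.
    have h : τ = 𝟙 _ := FreydTensor.hom_ext₁ fun b => S.zigzag_right a b
    exact fun X => NatTrans.congr_app h X
  -- With unit and counit prescribed, the two families proved above are precisely the triangle
  -- identities, and the required equalities hold by definition.
  exact ⟨{ unit := S.coevHat a
           counit := S.evHat a
           left_triangle_components := left
           right_triangle_components := right }, rfl, rfl⟩
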